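/- Let $(W_{ij})_{(i,j)\in\mathbb N^2}$ be an array of $\mathbb R^d$-valued random vectors on a probability space such that (1) (separate exchangeability) for all permutations $\pi_1,\pi_2$ of $\mathbb N$, the arrays $(W_{ij})_{(i,j)\in\mathbb N^2}$ and $(W_{\pi_1(i)\pi_2(j)})_{(i,j)\in\mathbb N^2}$ have the same law; (2) (dissociation) for all $(c_1,c_2)\in\mathbb N^2$, the block $(W_{ij})_{i\le c_1,\,j\le c_2}$ is independent of $(W_{ij})_{i>c_1,\,j>c_2}$. For all sample sizes $N,M$ let $p_{NM}\in[0,1]$, and let $Z_{ij}=Z_{ij}^{(N,M)}$, $1\le i\le N$, $1\le j\le M$, be i.i.d. Bernoulli$(p_{NM})$ random variables, independent of the data $(W_{ij})_{i\le N,\,j\le M}$. Put $\hat L=\sum_{i=1}^N\sum_{j=1}^M Z_{ij}$. All limits are taken as $\min\{N,M\}\to\infty$, and it is assumed that the expected subsample size tends to infinity: $NM\,p_{NM}\to\infty$. Let $\Theta\subset\mathbb R^k$ be compact, $\theta^0\in\operatorname{int}(\Theta)$, and let $g=(g_1,\dots,g_m)^T:\mathbb R^d\times\Theta\to\mathbb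 R^m$ be such that $g(\cdot,\theta)$ is measurable for each $\theta\in\Theta$. Assume that (3) there is a constant $K$ with $|g_r(w,\theta)-g_r(w,\theta')|\le K\|\theta-\theta'\|$ for all $r\in\{1,\dots,m\}$, all $\theta,\theta'\in\Theta$ and all $w\in\operatorname{supp}(W_{ij})$, the support of the common law of the $W_{ij}$; (4) $E\big[\sup_{\theta\in\Theta}\|g(W_{11},\theta)\|\big]<\infty$; (5) $E[g(W_{11},\theta^0)]=0$; (6) $V$ is a (symmetric) positive semi-definite $m\times m$ matrix, and for $\theta\in\Theta$, $V\,E[g(W_{11},\theta)]=0$ only if $\theta=\theta^0$. Let $\hat V=\hat V_{NM}$ be (symmetric) positive semi-definite random $m\times m$ matrices with $\hat V\to V$ in probability. Let $\hat\theta=\hat\theta_{NM}$ be the multiway algorithmic subsampling GMM estimator, that is, almost surely on the event $\{\hat L>0\}$, $\hat\theta$ is a maximizer over $\theta\in\Theta$ of $$\hat Q_{NM}(\theta)=-\hat g_{NM}(\theta)^T\hat V\hat g_{NM}(\theta),\qquad \hat g_{NM}(\theta)=\frac1{\hat L}\sum_{i=1}^N\sum_{j=1}^M Z_{ij}\,g(W_{ij},\theta)$$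 ($\hat\theta$ is arbitrary where $\hat L=0$). Then $\hat\theta\to\theta^0$ in probability as $\min\{N,M\}\to\infty$. -/

import Mathlib

open MeasureTheory ProbabilityTheory Filter
open scoped Matrix

namespace MultiwayGMM

/-- `ℝⁿ` with the Euclidean norm. -/
abbrev Vec (n : ℕ) : Type := EuclideanSpace ℝ (Fin n)

/-- The asymptotics `min {N, M} → ∞` for the sample sizes `(N, M)`. -/
def sizesToInfinity : Filter (ℕ × ℕ) :=
  Filter.comap (fun q : ℕ × ℕ => min q.1 q.2) Filter.atTop

/-- The array `W` is separately exchangeable: permuting the rows and the columns does not change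
the joint law of the whole array. (Indices start at `0`.) -/
def SeparatelyExchangeable {Ω : Type*} [MeasurableSpace Ω] (P : Measure Ω) {d : ℕ}
    (W : ℕ → ℕ → Ω → Vec d) : Prop :=
  ∀ π₁ π₂ : Equiv.Perm ℕ,
    IdentDistrib (fun ω (q : ℕ × ℕ) => W q.1 q.2 ω)
      (fun ω (q : ℕ × ℕ) => W (π₁ q.1) (π₂ q.2) ω) P P

/-- The array `W` is dissociated: for all `c₁, c₂`, the block of the first `c₁` rows and first `c₂`
columns is independent of the block of the remaining rows and remaining columns. -/
def Dissociated {Ω : Type*} [MeasurableSpace Ω] (P : Measure Ω) {d : ℕ}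
    (W : ℕ → ℕ → Ω → Vec d) : Prop :=
  ∀ c₁ c₂ : ℕ,
    IndepFun
      (fun ω (q : {q : ℕ × ℕ // q.1 < c₁ ∧ q.2 < c₂}) => W q.1.1 q.1.2 ω)
      (fun ω (q : {q : ℕ × ℕ // c₁ ≤ q.1 ∧ c₂ ≤ q.2}) => W q.1.1 q.1.2 ω) P

/-- For sample sizes `(N, M)`, the selection indicators `Z i j` are i.i.d. Bernoulli with success
probability `p`, independent of the data `(W i j)`, `i < N`, `j < M`. -/
structure IsBernoulliSubsample {Ω : Type*} [MeasurableSpace Ω] (P : Measure Ω) {d : ℕ}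
    (W : ℕ → ℕ → Ω → Vec d) (N M : ℕ) (p : unitInterval)
    (Z : Fin N → Fin M → Ω → ℝ) : Prop where
  measurable : ∀ i j, Measurable (Z i j)
  law : ∀ i j, P.map (Z i j) = bernoulliMeasure (1 : ℝ) 0 p
  indep : iIndepFun (fun (q : Fin N × Fin M) => Z q.1 q.2) P
  indep_data : IndepFun (fun ω (q : Fin N × Fin M) => Z q.1 q.2 ω)
    (fun ω (q : Fin N × Fin M) => W q.1 q.2 ω) P

/-- The size of the selected subsample, `L̂ = ∑ᵢ ∑ⱼ Zᵢⱼ`. -/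
noncomputable def subsampleSize {Ω : Type*} {N M : ℕ} (Z : Fin N → Fin M → Ω → ℝ) (ω : Ω) : ℝ :=
  ∑ i, ∑ j, Z i j ω

/-- The subsample moment `ĝ(θ) = L̂⁻¹ ∑ᵢ ∑ⱼ Zᵢⱼ g(Wᵢⱼ, θ)`. -/
noncomputable def sampleMoment {Ω : Type*} {d k m N M : ℕ} (W : ℕ → ℕ → Ω → Vec d)
    (g : Vec d → Vec k → Vec m) (Z : Fin N → Fin M → Ω → ℝ) (ω : Ω) (θ : Vec k) : Vec m :=
  (subsampleSize Z ω)⁻¹ • ∑ i : Fin N, ∑ j : Fin M, Z i j ω • g (W i j ω) θ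

/-- The GMM criterion `Q̂(θ) = - ĝ(θ)ᵀ V̂ ĝ(θ)`, with weighting matrix `V̂ = A`. -/
noncomputable def gmmCriterion {Ω : Type*} {d k m N M : ℕ} (W : ℕ → ℕ → Ω → Vec d)
    (g : Vec d → Vec k → Vec m) (Z : Fin N → Fin M → Ω → ℝ) (A : Matrix (Fin m) (Fin m) ℝ)
    (ω : Ω) (θ : Vec k) : ℝ :=
  -((sampleMoment W g Z ω θ).ofLp ⬝ᵥ (A *ᵥ (sampleMoment W g Z ω θ).ofLp))

/-- `θhat` is a GMM estimator over `Θ`: almost surely, whenever the subsample is nonempty (so that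
the criterion is defined), it maximizes the criterion over `Θ`. -/
def IsGMMEstimator {Ω : Type*} [MeasurableSpace Ω] (P : Measure Ω) {d k m N M : ℕ}
    (W : ℕ → ℕ → Ω → Vec d) (g : Vec d → Vec k → Vec m) (Z : Fin N → Fin M → Ω → ℝ)
    (Vhat : Ω → Matrix (Fin m) (Fin m) ℝ) (Θ : Set (Vec k)) (θhat : Ω → Vec k) : Prop :=
  ∀ᵐ ω ∂P, 0 < subsampleSize Z ω →
    θhat ω ∈ Θ ∧ IsMaxOn (gmmCriterion W g Z (Vhat ω) ω) Θ (θhat ω)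

/-- The population moment `E[g(W₁₁, θ)]`; all `Wᵢⱼ` have the same law. -/
noncomputable def populationMoment {Ω : Type*} [MeasurableSpace Ω] (P : Measure Ω) {d k m : ℕ}
    (W : ℕ → ℕ → Ω → Vec d) (g : Vec d → Vec k → Vec m) (θ : Vec k) : Vec m :=
  ∫ ω, g (W 0 0 ω) θ ∂P

end MultiwayGMM

/-! The proof joins a deterministic argmin argument to a weak law of large numbers. The link is
`highProbability`: convergence in probability to a constant is ordinary convergence along this
filter on pairs (index, outcome), so the deterministic argument applies unchanged to random
criteria.

Argmin (`tendsto_of_isMinOn_quadratic`): by compactness it suffices that every cluster point θ of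
the estimator is θ₀. The common Lipschitz constant turns pointwise convergence of the moments into
convergence at the moving point θhat. Comparison with the value at θ₀ gives G(θ)ᵀ V G(θ) ≤ 0, hence
V G(θ) = 0 by semidefiniteness, and θ = θ₀ by identification.

Law of large numbers (`tendsto_subsampleMean`): put a = NMp. For bounded centred f, two entries in
different rows and different columns are independent, so only pairs that share a row or a column
contribute to the second moment of the subsample sum. After division by a² this is of order 1/a +
1/N + 1/M. An integrable f is replaced by a bounded one, with an L¹ error that survives averaging
because selection is independent of the data. Finally L̂ / a → 1, since Var L̂ ≤ a, and a quotient
of limits finishes. -/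

namespace MultiwayGMM

open scoped Topology

/-! ### Convergence in probability as convergence along a filter -/

/-- The filter of events in `ι × Ω` whose probability tends to one along `l`: `f i` tends to a
constant in measure along `l` exactly if `f` tends to that constant along this filter. -/
def highProbability {ι Ω : Type*} [MeasurableSpace Ω] (P : Measure Ω) (l : Filter ι) :
    Filter (ι × Ω) where
  sets := {E | Tendsto (fun i => P {ω | (i, ω) ∉ E}) l (𝓝 0)}
  univ_sets := by simpa using tendsto_const_nhds
  sets_of_superset := by
    intro E E' hE hEE'
    exact tendsto_of_tendsto_of_tendsto_of_le_of_le tendsto_const_nhds hE (fun _ => zero_le)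
      (fun i => measure_mono fun ω hω h => hω (hEE' h))
  inter_sets := by
    intro E E' hE hE'
    have h := Tendsto.add hE hE'
    rw [add_zero] at h
    refine tendsto_of_tendsto_of_tendsto_of_le_of_le tendsto_const_nhds h (fun _ => zero_le)
      (fun i => (measure_mono fun ω hω => ?_).trans (measure_union_le _ _))
    by_cases h1 : (i, ω) ∈ E
    · exact Or.inr fun h2 => hω ⟨h1, h2⟩
    · exact Or.inl h1

section HighProbability

variable {ι Ω : Type*} [MeasurableSpace Ω] {P : Measure Ω} {l : Filter ι}

theorem eventually_highProbability_iff {p : ι × Ω → Prop} :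
    (∀ᶠ a in highProbability P l, p a) ↔ Tendsto (fun i => P {ω | ¬ p (i, ω)}) l (𝓝 0) :=
  Iff.rfl

theorem eventually_highProbability_of_ae {p : ι × Ω → Prop}
    (h : ∀ᶠ i in l, ∀ᵐ ω ∂P, p (i, ω)) : ∀ᶠ a in highProbability P l, p a := by
  rw [eventually_highProbability_iff]
  refine tendsto_const_nhds.congr' ?_
  filter_upwards [h] with i hi
  exact (ae_iff.mp hi).symm

/-- This gives convergence in probability the whole calculus of filter limits: sums, quotients,
continuous maps, and modification on events of vanishing probability. -/
theorem tendstoInMeasure_const_iff {E : Type*} [PseudoEMetricSpace E] {f : ι → Ω → E} {c : E} :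
    TendstoInMeasure P f l (fun _ => c) ↔
      Tendsto (fun a : ι × Ω => f a.1 a.2) (highProbability P l) (𝓝 c) := by
  rw [Metric.nhds_basis_eball.tendsto_right_iff]
  refine forall₂_congr fun ε _ => ?_
  simp [eventually_highProbability_iff]

/-- Convergence in mean implies convergence in probability. -/
theorem tendsto_highProbability_of_integral_abs [IsFiniteMeasure P] {S : ι → Ω → ℝ}
    (hS : ∀ᶠ i in l, Integrable (S i) P)
    (h : Tendsto (fun i => ∫ ω, |S i ω| ∂P) l (𝓝 0)) :
    Tendsto (fun a : ι × Ω => S a.1 a.2) (highProbability P l) (𝓝 0) := by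
  rw [Metric.nhds_basis_ball.tendsto_right_iff]
  intro ε hε
  rw [eventually_highProbability_iff]
  have h' : Tendsto (fun i => ENNReal.ofReal (ε⁻¹ * ∫ ω, |S i ω| ∂P)) l (𝓝 0) := by
    have := ENNReal.tendsto_ofReal (h.const_mul ε⁻¹)
    simpa using this
  refine tendsto_of_tendsto_of_tendsto_of_le_of_le' tendsto_const_nhds h'
    (Eventually.of_forall fun _ => zero_le) ?_
  filter_upwards [hS] with i hi
  -- Markov's inequality.
  have hm := mul_meas_ge_le_integral_of_nonneg (μ := P) (f := fun ω => |S i ω|)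
    (Eventually.of_forall fun ω => abs_nonneg _) hi.abs ε
  have hset : {ω | ¬ (S i ω) ∈ Metric.ball (0 : ℝ) ε} = {ω | ε ≤ |S i ω|} := by
    ext ω; simp
  change P {ω | ¬ (S i ω) ∈ Metric.ball (0 : ℝ) ε} ≤ _
  rw [hset, ENNReal.le_ofReal_iff_toReal_le (measure_ne_top _ _)
    (mul_nonneg (inv_nonneg.2 hε.le) (integral_nonneg fun _ => abs_nonneg _))]
  rw [inv_mul_eq_div, le_div_iff₀ hε, mul_comm]
  exact hm

end HighProbability

/-! ### Deterministic consistency of minimizers -/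

/-- Consistency of minimizers of a quadratic form in equi-Lipschitz, pointwise convergent
moments over a compact set. -/
theorem tendsto_of_isMinOn_quadratic {α : Type*} {F : Filter α} {k m : ℕ} {Θ : Set (Vec k)}
    (hΘ : IsCompact Θ) {θ₀ : Vec k} (hθ₀ : θ₀ ∈ Θ) {G : Vec k → Fin m → ℝ}
    (hG₀ : G θ₀ = 0) {V : Matrix (Fin m) (Fin m) ℝ} (hV : V.PosSemidef)
    (hid : ∀ θ ∈ Θ, V *ᵥ G θ = 0 → θ = θ₀)
    {H : α → Vec k → Fin m → ℝ} {A : α → Matrix (Fin m) (Fin m) ℝ} {θhat : α → Vec k} {K : ℝ}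
    (hLip : ∀ᶠ a in F, ∀ r, ∀ θ ∈ Θ, ∀ θ' ∈ Θ, |H a θ r - H a θ' r| ≤ K * ‖θ - θ'‖)
    (hH : ∀ θ ∈ Θ, Tendsto (fun a => H a θ) F (𝓝 (G θ)))
    (hA : Tendsto A F (𝓝 V)) (hmem : ∀ᶠ a in F, θhat a ∈ Θ)
    (hmin : ∀ᶠ a in F, IsMinOn (fun θ => H a θ ⬝ᵥ (A a *ᵥ H a θ)) Θ (θhat a)) :
    Tendsto θhat F (𝓝 θ₀) := by
  refine hΘ.tendsto_nhds_of_unique_mapClusterPt hmem fun θ hθ hcl => ?_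
  -- Along an ultrafilter finer than `F` the minimizers genuinely converge to the cluster point, so
  -- limits can be taken in the criterion.
  obtain ⟨U, hUF, hU⟩ := mapClusterPt_iff_ultrafilter.mp hcl
  have hquad : ∀ {B : α → Fin m → ℝ} {b : Fin m → ℝ}, Tendsto B U (𝓝 b) →
      Tendsto (fun a => B a ⬝ᵥ (A a *ᵥ B a)) U (𝓝 (b ⬝ᵥ (V *ᵥ b))) := by
    intro B b hB
    have hc : Continuous fun x : Matrix (Fin m) (Fin m) ℝ × (Fin m → ℝ) =>
        x.2 ⬝ᵥ (x.1 *ᵥ x.2) :=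
      continuous_snd.dotProduct (continuous_fst.matrix_mulVec continuous_snd)
    exact (hc.tendsto (V, b)).comp ((hA.mono_left hUF).prodMk_nhds hB)
  -- The Lipschitz bound replaces the moving argument `θhat a` by the fixed `θ`, at a cost tending
  -- to zero.
  have hHhat : Tendsto (fun a => H a (θhat a)) U (𝓝 (G θ)) := by
    rw [tendsto_pi_nhds]
    intro r
    have h1 : Tendsto (fun a => H a (θhat a) r - H a θ r) U (𝓝 0) := by
      have hn : Tendsto (fun a => K * ‖θhat a - θ‖) U (𝓝 0) := by
        have := ((tendsto_iff_norm_sub_tendsto_zero.mp hU).const_mul K)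
        simpa using this
      refine squeeze_zero_norm' ?_ hn
      filter_upwards [hUF hLip, hUF hmem] with a ha ha'
      exact ha r _ ha' _ hθ
    have h2 := h1.add ((tendsto_pi_nhds.mp (hH θ hθ) r).mono_left hUF)
    simpa using h2
  have hle : G θ ⬝ᵥ (V *ᵥ G θ) ≤ G θ₀ ⬝ᵥ (V *ᵥ G θ₀) := by
    refine le_of_tendsto_of_tendsto (hquad hHhat) (hquad ((hH θ₀ hθ₀).mono_left hUF)) ?_
    filter_upwards [hUF hmin] with a ha
    exact ha hθ₀
  rw [hG₀, zero_dotProduct] at hle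
  -- For semidefinite `V` the quadratic form vanishes only on the kernel, so singular weighting
  -- matrices are allowed.
  refine hid θ hθ ((hV.dotProduct_mulVec_zero_iff (G θ)).mp ?_)
  have h0 := hV.dotProduct_mulVec_nonneg (G θ)
  rw [star_trivial] at h0 ⊢
  exact le_antisymm hle h0

/-! ### Exchangeable dissociated arrays and moments of their Bernoulli subsamples -/

section Array

variable {Ω : Type*} [MeasurableSpace Ω] {P : Measure Ω} {d : ℕ} {W : ℕ → ℕ → Ω → Vec d}

theorem SeparatelyExchangeable.identDistrib_entry (h : SeparatelyExchangeable P W) (i j : ℕ) :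
    IdentDistrib (W 0 0) (W i j) P P := by
  have h1 := (h (Equiv.swap 0 i) (Equiv.swap 0 j)).comp
    (measurable_pi_apply ((0, 0) : ℕ × ℕ))
  simpa [Function.comp_def] using h1

/-- Applied to rows and to columns, this moves the diagonal positions (0, 0) and (1, 1) to any two
positions in different rows and columns. -/
theorem exists_perm_map_zero_one {i i' : ℕ} (h : i ≠ i') :
    ∃ π : Equiv.Perm ℕ, π 0 = i ∧ π 1 = i' := by
  -- The inner swap sends 0 to `i`; the outer one sends the image of 1 to `i'` and fixes `i`, which
  -- differs from both points it exchanges.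
  refine ⟨Equiv.swap (Equiv.swap 0 i 1) i' * Equiv.swap 0 i, ?_, by simp⟩
  have hne : i ≠ Equiv.swap 0 i 1 := fun h0 => by
    have : Equiv.swap 0 i 0 = Equiv.swap 0 i 1 := by rw [Equiv.swap_apply_left, ← h0]
    exact zero_ne_one ((Equiv.swap 0 i).injective this)
  simp [Equiv.swap_apply_of_ne_of_ne hne h]

theorem SeparatelyExchangeable.identDistrib_pair (h : SeparatelyExchangeable P W)
    {i i' j j' : ℕ} (hi : i ≠ i') (hj : j ≠ j') :
    IdentDistrib (fun ω => (W 0 0 ω, W 1 1 ω)) (fun ω => (W i j ω, W i' j' ω)) P P := by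
  obtain ⟨π₁, h1, h1'⟩ := exists_perm_map_zero_one hi
  obtain ⟨π₂, h2, h2'⟩ := exists_perm_map_zero_one hj
  have h3 := (h π₁ π₂).comp ((measurable_pi_apply ((0, 0) : ℕ × ℕ)).prodMk
    (measurable_pi_apply ((1, 1) : ℕ × ℕ)))
  simpa [Function.comp_def, h1, h1', h2, h2'] using h3

/-- The case `c₁ = c₂ = 1` suffices: (0, 0) is the whole first block and (1, 1) lies in the second.
-/
theorem Dissociated.indepFun_diagonal (h : Dissociated P W) : IndepFun (W 0 0) (W 1 1) P :=
  (h 1 1).comp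
    (measurable_pi_apply (⟨(0, 0), by simp⟩ : {q : ℕ × ℕ // q.1 < 1 ∧ q.2 < 1}))
    (measurable_pi_apply (⟨(1, 1), by simp⟩ : {q : ℕ × ℕ // 1 ≤ q.1 ∧ 1 ≤ q.2}))

/-- Entries in different rows and columns are uncorrelated. -/
theorem integral_mul_eq_zero_of_ne (hW : ∀ i j, Measurable (W i j))
    (hexch : SeparatelyExchangeable P W) (hdiss : Dissociated P W) {f : Vec d → ℝ}
    (hf : Measurable f) (h0 : ∫ ω, f (W 0 0 ω) ∂P = 0)
    {i i' j j' : ℕ} (hi : i ≠ i') (hj : j ≠ j') :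
    ∫ ω, f (W i j ω) * f (W i' j' ω) ∂P = 0 := by
  have h1 := ((hexch.identDistrib_pair hi hj).comp
    ((hf.comp measurable_fst).mul (hf.comp measurable_snd))).integral_eq
  have h2 := (hdiss.indepFun_diagonal.comp hf hf).integral_fun_mul_eq_mul_integral
    (hf.comp (hW 0 0)).aestronglyMeasurable (hf.comp (hW 1 1)).aestronglyMeasurable
  simp only [Function.comp_def, Pi.mul_apply] at h1 h2
  rw [← h1, h2, h0, zero_mul]

variable {N M : ℕ} {p : unitInterval} {Z : Fin N → Fin M → Ω → ℝ}

theorem ae_bernoulliMeasure (p : unitInterval) :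
    ∀ᵐ x ∂bernoulliMeasure (1 : ℝ) 0 p, x = 1 ∨ x = 0 := by
  have h : {x : ℝ | ¬ (x = 1 ∨ x = 0)} = ({1, 0} : Set ℝ)ᶜ := by ext; simp
  rw [ae_iff, h, bernoulliMeasure_apply_of_notMem_of_notMem p
    (Set.toFinite ({1, 0} : Set ℝ)).measurableSet.compl] <;> simp

theorem IsBernoulliSubsample.ae_eq_one_or_zero (hZ : IsBernoulliSubsample P W N M p Z)
    (i : Fin N) (j : Fin M) : ∀ᵐ ω ∂P, Z i j ω = 1 ∨ Z i j ω = 0 := by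
  have h := ae_bernoulliMeasure p
  rw [← hZ.law i j] at h
  exact ae_of_ae_map (hZ.measurable i j).aemeasurable h

theorem IsBernoulliSubsample.ae_abs_le_one (hZ : IsBernoulliSubsample P W N M p Z)
    (i : Fin N) (j : Fin M) : ∀ᵐ ω ∂P, ‖Z i j ω‖ ≤ 1 := by
  filter_upwards [hZ.ae_eq_one_or_zero i j] with ω h
  rcases h with h | h <;> simp [h]

theorem IsBernoulliSubsample.integral_comp (hZ : IsBernoulliSubsample P W N M p Z)
    (i : Fin N) (j : Fin M) {φ : ℝ → ℝ} (hφ : Measurable φ) :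
    ∫ ω, φ (Z i j ω) ∂P = p * φ 1 + (1 - p) * φ 0 := by
  rw [← integral_map (hZ.measurable i j).aemeasurable hφ.aestronglyMeasurable, hZ.law,
    integral_bernoulliMeasure]
  simp

theorem IsBernoulliSubsample.integral_eq (hZ : IsBernoulliSubsample P W N M p Z)
    (i : Fin N) (j : Fin M) : ∫ ω, Z i j ω ∂P = p := by
  simpa using hZ.integral_comp i j measurable_id

theorem IsBernoulliSubsample.integral_mul (hZ : IsBernoulliSubsample P W N M p Z)
    (q q' : Fin N × Fin M) :
    ∫ ω, Z q.1 q.2 ω * Z q'.1 q'.2 ω ∂P = if q = q' then (p : ℝ) else p ^ 2 := by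
  split_ifs with h
  · subst h
    simpa using hZ.integral_comp q.1 q.2 (measurable_id.mul measurable_id)
  · rw [(hZ.indep.indepFun h).integral_fun_mul_eq_mul_integral
      (hZ.measurable _ _).aestronglyMeasurable (hZ.measurable _ _).aestronglyMeasurable,
      hZ.integral_eq, hZ.integral_eq, sq]

theorem IsBernoulliSubsample.indepFun_comp (hZ : IsBernoulliSubsample P W N M p Z)
    {φ : (Fin N × Fin M → ℝ) → ℝ} {ψ : (Fin N × Fin M → Vec d) → ℝ} (hφ : Measurable φ)
    (hψ : Measurable ψ) :
    IndepFun (fun ω => φ fun q => Z q.1 q.2 ω) (fun ω => ψ fun q => W q.1 q.2 ω) P :=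
  hZ.indep_data.comp hφ hψ

/-- The sum of `f` over the selected subsample. -/
noncomputable def subsampleSum (W : ℕ → ℕ → Ω → Vec d) (f : Vec d → ℝ)
    (Z : Fin N → Fin M → Ω → ℝ) (ω : Ω) : ℝ :=
  ∑ q : Fin N × Fin M, Z q.1 q.2 ω * f (W q.1 q.2 ω)

theorem IsBernoulliSubsample.integrable_mul [IsFiniteMeasure P]
    (hZ : IsBernoulliSubsample P W N M p Z) {X : Ω → ℝ} (hX : Integrable X P) (i : Fin N)
    (j : Fin M) : Integrable (fun ω => Z i j ω * X ω) P :=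
  hX.bdd_mul (hZ.measurable i j).aestronglyMeasurable (hZ.ae_abs_le_one i j)

theorem IsBernoulliSubsample.integrable_subsampleSum [IsFiniteMeasure P]
    (hZ : IsBernoulliSubsample P W N M p Z) (hexch : SeparatelyExchangeable P W)
    {f : Vec d → ℝ} (hf : Measurable f) (hint : Integrable (fun ω => f (W 0 0 ω)) P) :
    Integrable (subsampleSum W f Z) P :=
  integrable_finsetSum _ fun q _ => hZ.integrable_mul
    ((((hexch.identDistrib_entry q.1 q.2).comp hf).integrable_iff).mp hint) _ _

/-- Triangle inequality, then each term factors by independence of selection and data. The bound is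
linear in the L¹ norm of `f`, which makes the approximation error harmless after division by NMp. -/
theorem IsBernoulliSubsample.integral_abs_subsampleSum_le [IsFiniteMeasure P]
    (hZ : IsBernoulliSubsample P W N M p Z) (hW : ∀ i j, Measurable (W i j))
    (hexch : SeparatelyExchangeable P W)
    {f : Vec d → ℝ} (hf : Measurable f) (hint : Integrable (fun ω => f (W 0 0 ω)) P) :
    ∫ ω, |subsampleSum W f Z ω| ∂P ≤ N * M * p * ∫ ω, |f (W 0 0 ω)| ∂P := by
  have hterm : ∀ q : Fin N × Fin M, Integrable (fun ω => Z q.1 q.2 ω * f (W q.1 q.2 ω)) P :=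
    fun q => hZ.integrable_mul
      ((((hexch.identDistrib_entry q.1 q.2).comp hf).integrable_iff).mp hint) _ _
  calc ∫ ω, |subsampleSum W f Z ω| ∂P
      ≤ ∫ ω, ∑ q : Fin N × Fin M, |Z q.1 q.2 ω * f (W q.1 q.2 ω)| ∂P :=
        integral_mono (hZ.integrable_subsampleSum hexch hf hint).abs
          (integrable_finsetSum _ fun q _ => (hterm q).abs)
          fun ω => Finset.abs_sum_le_sum_abs _ _
    _ = ∑ q : Fin N × Fin M, ∫ ω, |Z q.1 q.2 ω * f (W q.1 q.2 ω)| ∂P :=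
        integral_finsetSum _ fun q _ => (hterm q).abs
    _ = ∑ q : Fin N × Fin M, (p : ℝ) * ∫ ω, |f (W 0 0 ω)| ∂P := by
        refine Finset.sum_congr rfl fun q _ => ?_
        simp only [abs_mul]
        rw [(hZ.indepFun_comp (φ := fun z => |z q|) (ψ := fun w => |f (w q)|)
          (by fun_prop) (by fun_prop)).integral_fun_mul_eq_mul_integral
          (hZ.measurable _ _).abs.aestronglyMeasurable
          (hf.comp (hW _ _)).abs.aestronglyMeasurable]
        have h1 := hZ.integral_comp q.1 q.2 (φ := fun x => |x|) (by fun_prop)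
        have h2 := ((hexch.identDistrib_entry q.1 q.2).comp hf.abs).integral_eq
        simp only [Function.comp_def] at h2
        rw [h1, ← h2]
        simp
    _ = N * M * p * ∫ ω, |f (W 0 0 ω)| ∂P := by simp; ring

/-- Expand the square over pairs of positions. The three summands count the NM equal pairs (weight
p), the NM² pairs in a common row and the N²M pairs in a common column (weight p²); all other pairs
have zero expectation. -/
theorem IsBernoulliSubsample.integral_sq_subsampleSum_le [IsProbabilityMeasure P]
    (hZ : IsBernoulliSubsample P W N M p Z) (hW : ∀ i j, Measurable (W i j))
    (hexch : SeparatelyExchangeable P W) (hdiss : Dissociated P W)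
    {f : Vec d → ℝ} (hf : Measurable f) {B : ℝ} (hB : ∀ w, |f w| ≤ B)
    (h0 : ∫ ω, f (W 0 0 ω) ∂P = 0) :
    ∫ ω, (subsampleSum W f Z ω) ^ 2 ∂P
      ≤ B ^ 2 * (N * M * p + N * M ^ 2 * p ^ 2 + N ^ 2 * M * p ^ 2) := by
  have hprod : ∀ q q' : Fin N × Fin M,
      Integrable (fun ω => f (W q.1 q.2 ω) * f (W q'.1 q'.2 ω)) P := fun q q' =>
    (integrable_const (B * B)).mono' ((hf.comp (hW _ _)).mul (hf.comp (hW _ _))).aestronglyMeasurable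
      (Eventually.of_forall fun ω => by
        rw [Real.norm_eq_abs, abs_mul]
        exact mul_le_mul (hB _) (hB _) (abs_nonneg _) ((abs_nonneg _).trans (hB (W 0 0 ω))))
  have hterm : ∀ q q' : Fin N × Fin M, Integrable
      (fun ω => (Z q.1 q.2 ω * f (W q.1 q.2 ω)) * (Z q'.1 q'.2 ω * f (W q'.1 q'.2 ω))) P := by
    intro q q'
    refine (hZ.integrable_mul (hZ.integrable_mul (hprod q q') q'.1 q'.2) q.1 q.2).congr
      (Eventually.of_forall fun ω => ?_)
    ring
  have hval : ∀ q q' : Fin N × Fin M,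
      ∫ ω, (Z q.1 q.2 ω * f (W q.1 q.2 ω)) * (Z q'.1 q'.2 ω * f (W q'.1 q'.2 ω)) ∂P
        = (if q = q' then (p : ℝ) else p ^ 2)
          * ∫ ω, f (W q.1 q.2 ω) * f (W q'.1 q'.2 ω) ∂P := by
    intro q q'
    rw [← hZ.integral_mul q q', ← (hZ.indepFun_comp (φ := fun z => z q * z q')
      (ψ := fun w => f (w q) * f (w q'))
      (by fun_prop) (by fun_prop)).integral_fun_mul_eq_mul_integral
      ((hZ.measurable _ _).mul (hZ.measurable _ _)).aestronglyMeasurable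
      ((hf.comp (hW _ _)).mul (hf.comp (hW _ _))).aestronglyMeasurable]
    refine integral_congr_ae (Eventually.of_forall fun ω => ?_)
    simp only
    ring
  have hcov : ∀ q q' : Fin N × Fin M, ∫ ω, f (W q.1 q.2 ω) * f (W q'.1 q'.2 ω) ∂P ≤ B ^ 2 := by
    intro q q'
    calc _ ≤ ∫ _, B ^ 2 ∂P := integral_mono (hprod q q') (integrable_const _) fun ω => by
          refine (le_abs_self _).trans ?_
          rw [abs_mul, sq]
          exact mul_le_mul (hB _) (hB _) (abs_nonneg _) ((abs_nonneg _).trans (hB (W 0 0 ω)))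
      _ = B ^ 2 := by simp
  have hp0 : (0 : ℝ) ≤ p := p.2.1
  -- Equal pairs are also counted in the row and column terms; the overcount is nonnegative and lets
  -- each indicator be summed separately.
  have hle : ∀ q q' : Fin N × Fin M,
      ∫ ω, (Z q.1 q.2 ω * f (W q.1 q.2 ω)) * (Z q'.1 q'.2 ω * f (W q'.1 q'.2 ω)) ∂P
        ≤ (if q = q' then p * B ^ 2 else 0) + (if q.1 = q'.1 then p ^ 2 * B ^ 2 else 0)
          + (if q.2 = q'.2 then p ^ 2 * B ^ 2 else 0) := by
    intro q q'
    rw [hval]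
    have hpB : 0 ≤ (p : ℝ) ^ 2 * B ^ 2 := by positivity
    have hsq := mul_le_mul_of_nonneg_left (hcov q q') (sq_nonneg (p : ℝ))
    by_cases hq : q = q'
    · subst hq
      have := mul_le_mul_of_nonneg_left (hcov q q) hp0
      simp only [if_true]
      linarith
    · by_cases h1 : q.1 = q'.1
      · by_cases h2 : q.2 = q'.2
        · exact absurd (Prod.ext h1 h2) hq
        · simpa [hq, h1, h2] using hsq
      · by_cases h2 : q.2 = q'.2
        · simpa [hq, h1, h2] using hsq
        · rw [integral_mul_eq_zero_of_ne hW hexch hdiss hf h0 (Fin.val_ne_of_ne h1)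
            (Fin.val_ne_of_ne h2)]
          simp [hq, h1, h2]
  calc ∫ ω, (subsampleSum W f Z ω) ^ 2 ∂P
      = ∫ ω, ∑ q : Fin N × Fin M, ∑ q' : Fin N × Fin M,
          (Z q.1 q.2 ω * f (W q.1 q.2 ω)) * (Z q'.1 q'.2 ω * f (W q'.1 q'.2 ω)) ∂P := by
        simp only [subsampleSum, sq, Finset.sum_mul_sum]
    _ = ∑ q : Fin N × Fin M, ∑ q' : Fin N × Fin M,
          ∫ ω, (Z q.1 q.2 ω * f (W q.1 q.2 ω)) * (Z q'.1 q'.2 ω * f (W q'.1 q'.2 ω)) ∂P := by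
        rw [integral_finsetSum _ fun q _ => integrable_finsetSum _ fun q' _ => hterm q q']
        exact Finset.sum_congr rfl fun q _ => integral_finsetSum _ fun q' _ => hterm q q'
    _ ≤ ∑ q : Fin N × Fin M, ∑ q' : Fin N × Fin M,
          ((if q = q' then p * B ^ 2 else 0) + (if q.1 = q'.1 then p ^ 2 * B ^ 2 else 0)
          + (if q.2 = q'.2 then p ^ 2 * B ^ 2 else 0)) :=
        Finset.sum_le_sum fun q _ => Finset.sum_le_sum fun q' _ => hle q q'
    _ = B ^ 2 * (N * M * p + N * M ^ 2 * p ^ 2 + N ^ 2 * M * p ^ 2) := by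
        have hrow : ∀ (x : Fin N) (c : ℝ),
            ∑ q' : Fin N × Fin M, (if x = q'.1 then c else 0) = M * c := fun x c => by
          rw [Fintype.sum_prod_type_right]
          simp
        have hcol : ∀ (x : Fin M) (c : ℝ),
            ∑ q' : Fin N × Fin M, (if x = q'.2 then c else 0) = N * c := fun x c => by
          rw [Fintype.sum_prod_type]
          simp
        simp only [Finset.sum_add_distrib, hrow, hcol]
        simp
        ring

/-- The variance of the subsample size is at most its mean. -/
theorem IsBernoulliSubsample.integral_sq_subsampleSize_sub_le [IsProbabilityMeasure P]
    (hZ : IsBernoulliSubsample P W N M p Z) :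
    Integrable (fun ω => (subsampleSize Z ω - N * M * p) ^ 2) P ∧
    ∫ ω, (subsampleSize Z ω - N * M * p) ^ 2 ∂P ≤ N * M * p := by
  have hsum : ∀ ω, subsampleSize Z ω = (∑ q : Fin N × Fin M, fun ω => Z q.1 q.2 ω) ω := by
    intro ω
    simp [subsampleSize, Fintype.sum_prod_type]
  have hL : ∀ q : Fin N × Fin M, MemLp (fun ω => Z q.1 q.2 ω) 2 P := fun q =>
    MemLp.of_bound (hZ.measurable _ _).aestronglyMeasurable 1 (hZ.ae_abs_le_one _ _)
  have hLs : MemLp (∑ q : Fin N × Fin M, fun ω => Z q.1 q.2 ω) 2 P :=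
    memLp_finsetSum' _ fun q _ => hL q
  have hmean : ∫ ω, (∑ q : Fin N × Fin M, fun ω => Z q.1 q.2 ω) ω ∂P = N * M * p := by
    simp only [Finset.sum_apply]
    rw [integral_finsetSum _ fun q _ => (hL q).integrable (by norm_num)]
    simp [hZ.integral_eq]
  have hvar := IndepFun.variance_sum (μ := P) (s := Finset.univ)
    (X := fun (q : Fin N × Fin M) ω => Z q.1 q.2 ω) (fun q _ => hL q)
    (fun q _ q' _ hq => hZ.indep.indepFun hq)
  rw [variance_eq_integral hLs.aestronglyMeasurable.aemeasurable, hmean] at hvar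
  simp only [hsum]
  refine ⟨(hLs.sub (memLp_const _)).integrable_sq, hvar.trans_le ?_⟩
  -- Each variance is at most the second moment, which is p for a 0-1 variable.
  calc _ ≤ ∑ q : Fin N × Fin M, (p : ℝ) := Finset.sum_le_sum fun q _ => by
        refine (variance_le_expectation_sq (hL q).aestronglyMeasurable).trans_eq ?_
        have := hZ.integral_comp q.1 q.2 (φ := fun x => x ^ 2) (by fun_prop)
        simpa using this
    _ = N * M * p := by simp

end Array

/-! ### Weak law of large numbers for the subsample -/

theorem tendsto_fst_sizesToInfinity :
    Tendsto (fun q : ℕ × ℕ => (q.1 : ℝ)) sizesToInfinity atTop :=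
  tendsto_natCast_atTop_atTop.comp
    (tendsto_atTop_mono (fun q : ℕ × ℕ => min_le_left q.1 q.2) tendsto_comap)

theorem tendsto_snd_sizesToInfinity :
    Tendsto (fun q : ℕ × ℕ => (q.2 : ℝ)) sizesToInfinity atTop :=
  tendsto_natCast_atTop_atTop.comp
    (tendsto_atTop_mono (fun q : ℕ × ℕ => min_le_right q.1 q.2) tendsto_comap)

section LawOfLargeNumbers

variable {Ω : Type*} [MeasurableSpace Ω] {P : Measure Ω} [IsProbabilityMeasure P] {d : ℕ}
  {W : ℕ → ℕ → Ω → Vec d} {p : ℕ → ℕ → unitInterval} {Z : (N M : ℕ) → Fin N → Fin M → Ω → ℝ}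

/-- An integrable function with mean zero is, up to a small error in mean, bounded with mean
zero. -/
theorem exists_bounded_mean_zero_approx {X : Ω → Vec d} (hX : Measurable X) {f : Vec d → ℝ}
    (hf : Measurable f) (hint : Integrable (fun ω => f (X ω)) P) (h0 : ∫ ω, f (X ω) ∂P = 0)
    {ε : ℝ} (hε : 0 < ε) :
    ∃ h : Vec d → ℝ, Measurable h ∧ (∃ B, ∀ w, |h w| ≤ B) ∧ ∫ ω, h (X ω) ∂P = 0 ∧
      ∫ ω, |f (X ω) - h (X ω)| ∂P ≤ ε := by
  have hmem : MemLp f 1 (P.map X) :=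
    memLp_one_iff_integrable.mpr ((integrable_map_measure hf.aestronglyMeasurable
      hX.aemeasurable).mpr hint)
  -- A simple function within ε/2 in L¹; since `f` is centred, the mean of `s` is at most ε/2 in
  -- absolute value, so recentring costs another ε/2.
  obtain ⟨s, hs, hs'⟩ := hmem.exists_simpleFunc_eLpNorm_sub_lt ENNReal.one_ne_top
    (ε := ENNReal.ofReal (ε / 2)) (by simpa using hε)
  obtain ⟨C, hC⟩ := s.exists_forall_norm_le
  have hsX : Integrable (fun ω => s (X ω)) P :=
    (memLp_one_iff_integrable.mp hs').comp_measurable hX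
  have hsub : ∫ ω, |f (X ω) - s (X ω)| ∂P ≤ ε / 2 := by
    rw [eLpNorm_map_measure (hmem.sub hs').aestronglyMeasurable hX.aemeasurable,
      eLpNorm_one_eq_lintegral_enorm] at hs
    have h1 := ofReal_integral_norm_eq_lintegral_enorm (hint.sub hsX)
    simp only [Function.comp_def, Pi.sub_apply] at hs h1
    rw [← h1] at hs
    exact ((ENNReal.ofReal_lt_ofReal_iff (by linarith)).mp hs).le
  have hc : |∫ ω, s (X ω) ∂P| ≤ ε / 2 := by
    have h1 : ∫ ω, s (X ω) ∂P = - ∫ ω, (f (X ω) - s (X ω)) ∂P := by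
      rw [integral_sub hint hsX, h0]
      ring
    rw [h1, abs_neg]
    exact (abs_integral_le_integral_abs).trans hsub
  refine ⟨fun w => s w - ∫ ω, s (X ω) ∂P, s.measurable.sub_const _,
    ⟨C + ε / 2, fun w => (abs_sub _ _).trans (add_le_add (hC w) hc)⟩, ?_, ?_⟩
  · rw [integral_sub hsX (integrable_const _)]
    simp
  · calc ∫ ω, |f (X ω) - (s (X ω) - ∫ ω, s (X ω) ∂P)| ∂P
        ≤ ∫ ω, (|f (X ω) - s (X ω)| + ε / 2) ∂P := by
          refine integral_mono (hint.sub (hsX.sub (integrable_const _))).abs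
            ((hint.sub hsX).abs.add (integrable_const _)) fun ω => ?_
          simp only
          rw [← sub_add]
          exact (abs_add_le _ _).trans (add_le_add le_rfl hc)
      _ = ∫ ω, |f (X ω) - s (X ω)| ∂P + ε / 2 := by
          have hi : Integrable (fun ω => |f (X ω) - s (X ω)|) P := (hint.sub hsX).abs
          rw [integral_add hi (integrable_const _)]
          simp
      _ ≤ ε := by linarith

/-- The mean law of large numbers for Bernoulli subsamples of a dissociated array. -/
theorem tendsto_integral_abs_subsampleSum (hW : ∀ i j, Measurable (W i j))
    (hexch : SeparatelyExchangeable P W) (hdiss : Dissociated P W)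
    (hp : Tendsto (fun q : ℕ × ℕ => (q.1 : ℝ) * (q.2 : ℝ) * (p q.1 q.2 : ℝ))
      sizesToInfinity atTop)
    (hZ : ∀ N M, IsBernoulliSubsample P W N M (p N M) (Z N M)) {f : Vec d → ℝ}
    (hf : Measurable f) (hint : Integrable (fun ω => f (W 0 0 ω)) P)
    (h0 : ∫ ω, f (W 0 0 ω) ∂P = 0) :
    Tendsto (fun q : ℕ × ℕ => ∫ ω, |((q.1 : ℝ) * q.2 * p q.1 q.2)⁻¹ *
      subsampleSum W f (Z q.1 q.2) ω| ∂P) sizesToInfinity (𝓝 0) := by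
  rw [Metric.nhds_basis_closedBall.tendsto_right_iff]
  intro ε hε
  obtain ⟨h, hh, ⟨B, hB⟩, hh0, hfh⟩ :=
    exists_bounded_mean_zero_approx (hW 0 0) hf hint h0 (ε := ε / 3) (by linarith)
  have hhint : Integrable (fun ω => h (W 0 0 ω)) P :=
    (integrable_const B).mono' (hh.comp (hW 0 0)).aestronglyMeasurable
      (Eventually.of_forall fun ω => hB _)
  -- The second moment bound divided by (NMp)²: equal, same-row and same-column pairs give the three
  -- inverses in this order.
  have hlim : Tendsto (fun q : ℕ × ℕ => B ^ 2 * (((q.1 : ℝ) * q.2 * p q.1 q.2)⁻¹ +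
      (q.1 : ℝ)⁻¹ + (q.2 : ℝ)⁻¹)) sizesToInfinity (𝓝 0) := by
    have := ((hp.inv_tendsto_atTop.add tendsto_fst_sizesToInfinity.inv_tendsto_atTop).add
      tendsto_snd_sizesToInfinity.inv_tendsto_atTop).const_mul (B ^ 2)
    simpa using this
  have hε2 : 0 < (ε / 3) ^ 2 := by positivity
  filter_upwards [hlim.eventually_le_const hε2, hp.eventually_gt_atTop 0,
    tendsto_fst_sizesToInfinity.eventually_gt_atTop 0,
    tendsto_snd_sizesToInfinity.eventually_gt_atTop 0] with q hq ha hN hM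
  set a : ℝ := (q.1 : ℝ) * q.2 * p q.1 q.2 with ha_def
  have hz := hZ q.1 q.2
  have hfhint : Integrable (fun ω => f (W 0 0 ω) - h (W 0 0 ω)) P := hint.sub hhint
  have hI2 := hz.integrable_subsampleSum (f := fun w => f w - h w) hexch (hf.sub hh) hfhint
  have hI := hz.integrable_subsampleSum hexch hf hint
  have hrest := hz.integral_abs_subsampleSum_le (f := fun w => f w - h w) hW hexch
    (hf.sub hh) hfhint
  have hsq := hz.integral_sq_subsampleSum_le hW hexch hdiss hh hB hh0
  have hsplit : ∀ ω, subsampleSum W f (Z q.1 q.2) ω = subsampleSum W h (Z q.1 q.2) ω +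
      subsampleSum W (fun w => f w - h w) (Z q.1 q.2) ω := fun ω => by
    simp only [subsampleSum, ← Finset.sum_add_distrib]
    exact Finset.sum_congr rfl fun _ _ => by ring
  have hsqint : Integrable (fun ω => subsampleSum W h (Z q.1 q.2) ω ^ 2) P := by
    refine MemLp.integrable_sq (memLp_finsetSum _ fun q' _ => ?_)
    refine MemLp.of_bound ((hz.measurable _ _).mul
      (hh.comp (hW _ _))).aestronglyMeasurable B ?_
    filter_upwards [hz.ae_abs_le_one q'.1 q'.2] with ω hω
    rw [norm_mul]
    exact (mul_le_mul hω (hB _) (abs_nonneg _) zero_le_one).trans_eq (one_mul B)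
  -- The bounded part uses |x| ≤ η + η⁻¹x² with η = (ε/3)a, in place of Cauchy–Schwarz. After
  -- division by a, the constant, the second moment and the approximation error each contribute at
  -- most ε/3.
  have hbound : ∫ ω, |subsampleSum W f (Z q.1 q.2) ω| ∂P ≤
      (ε / 3 * a + (ε / 3 * a)⁻¹ * (∫ ω, subsampleSum W h (Z q.1 q.2) ω ^ 2 ∂P)) +
      ∫ ω, |subsampleSum W (fun w => f w - h w) (Z q.1 q.2) ω| ∂P := by
    have hc : ∫ ω, (ε / 3 * a + (ε / 3 * a)⁻¹ * subsampleSum W h (Z q.1 q.2) ω ^ 2) ∂P =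
        ε / 3 * a + (ε / 3 * a)⁻¹ * (∫ ω, subsampleSum W h (Z q.1 q.2) ω ^ 2 ∂P) := by
      rw [integral_add (integrable_const _) (hsqint.const_mul _), integral_const,
        probReal_univ, one_smul, integral_const_mul]
    have hi : Integrable
        (fun ω => ε / 3 * a + (ε / 3 * a)⁻¹ * subsampleSum W h (Z q.1 q.2) ω ^ 2) P :=
      (integrable_const _).add (hsqint.const_mul _)
    rw [← hc, ← integral_add hi hI2.abs]
    refine integral_mono hI.abs (hi.add hI2.abs) fun ω => ?_
    simp only [hsplit]
    refine (abs_add_le _ _).trans (add_le_add ?_ le_rfl)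
    have hpos : 0 < ε / 3 * a := by positivity
    generalize subsampleSum W h (Z q.1 q.2) ω = x
    generalize ε / 3 * a = η at hpos
    rw [← sub_nonneg]
    -- Completing the square shows that the difference is nonnegative.
    have : η + η⁻¹ * x ^ 2 - |x| = η⁻¹ * ((η - |x| / 2) ^ 2 + 3 / 4 * x ^ 2) := by
      field_simp
      nlinarith [sq_abs x]
    rw [this]
    positivity
  have hval : a⁻¹ * ((ε / 3 * a)⁻¹ * (B ^ 2 * (a + q.1 * q.2 ^ 2 * p q.1 q.2 ^ 2 +
      q.1 ^ 2 * q.2 * p q.1 q.2 ^ 2))) =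
      (ε / 3)⁻¹ * (B ^ 2 * (a⁻¹ + (q.1 : ℝ)⁻¹ + (q.2 : ℝ)⁻¹)) := by
    have hp0 : (p q.1 q.2 : ℝ) ≠ 0 := by
      intro h
      rw [ha_def, h, mul_zero] at ha
      exact lt_irrefl _ ha
    rw [ha_def]
    field_simp
  have hle1 : a⁻¹ * ((ε / 3 * a)⁻¹ * (∫ ω, subsampleSum W h (Z q.1 q.2) ω ^ 2 ∂P)) ≤ ε / 3 := by
    calc _ ≤ a⁻¹ * ((ε / 3 * a)⁻¹ * (B ^ 2 * (a + q.1 * q.2 ^ 2 * p q.1 q.2 ^ 2 +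
          q.1 ^ 2 * q.2 * p q.1 q.2 ^ 2))) := by gcongr
      _ = (ε / 3)⁻¹ * (B ^ 2 * (a⁻¹ + (q.1 : ℝ)⁻¹ + (q.2 : ℝ)⁻¹)) := hval
      _ ≤ (ε / 3)⁻¹ * (ε / 3) ^ 2 := by gcongr
      _ = ε / 3 := by field_simp
  have hle2 : a⁻¹ * ∫ ω, |subsampleSum W (fun w => f w - h w) (Z q.1 q.2) ω| ∂P ≤ ε / 3 := by
    calc _ ≤ a⁻¹ * (a * (ε / 3)) := by
          gcongr
          exact hrest.trans (by gcongr)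
      _ = ε / 3 := by field_simp
  rw [mem_closedBall_zero_iff, Real.norm_eq_abs,
    abs_of_nonneg (integral_nonneg fun _ => abs_nonneg _)]
  simp only [abs_mul, abs_of_pos (inv_pos.mpr ha)]
  rw [integral_const_mul]
  calc _ ≤ a⁻¹ * ((ε / 3 * a + (ε / 3 * a)⁻¹ *
        (∫ ω, subsampleSum W h (Z q.1 q.2) ω ^ 2 ∂P)) +
        ∫ ω, |subsampleSum W (fun w => f w - h w) (Z q.1 q.2) ω| ∂P) := by gcongr
    _ = ε / 3 * (a⁻¹ * a) + a⁻¹ * ((ε / 3 * a)⁻¹ *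
        (∫ ω, subsampleSum W h (Z q.1 q.2) ω ^ 2 ∂P)) +
        a⁻¹ * ∫ ω, |subsampleSum W (fun w => f w - h w) (Z q.1 q.2) ω| ∂P := by ring
    _ ≤ ε / 3 * 1 + ε / 3 + ε / 3 := by
        rw [inv_mul_cancel₀ ha.ne']
        gcongr
    _ = ε := by ring

/-- The subsample size is asymptotically equivalent to its mean, in probability. -/
theorem tendsto_subsampleSize_div
    (hp : Tendsto (fun q : ℕ × ℕ => (q.1 : ℝ) * (q.2 : ℝ) * (p q.1 q.2 : ℝ))
      sizesToInfinity atTop)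
    (hZ : ∀ N M, IsBernoulliSubsample P W N M (p N M) (Z N M)) :
    Tendsto (fun a : (ℕ × ℕ) × Ω => ((a.1.1 : ℝ) * a.1.2 * p a.1.1 a.1.2)⁻¹ *
      subsampleSize (Z a.1.1 a.1.2) a.2) (highProbability P sizesToInfinity) (𝓝 1) := by
  -- The expected squared relative deviation is at most a⁻² · a = a⁻¹.
  have hsq : Tendsto (fun a : (ℕ × ℕ) × Ω => (((a.1.1 : ℝ) * a.1.2 * p a.1.1 a.1.2)⁻¹) ^ 2 *
      (subsampleSize (Z a.1.1 a.1.2) a.2 - (a.1.1 : ℝ) * a.1.2 * p a.1.1 a.1.2) ^ 2)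
      (highProbability P sizesToInfinity) (𝓝 0) := by
    refine tendsto_highProbability_of_integral_abs (S := fun (q : ℕ × ℕ) ω =>
      (((q.1 : ℝ) * q.2 * p q.1 q.2)⁻¹) ^ 2 *
      (subsampleSize (Z q.1 q.2) ω - (q.1 : ℝ) * q.2 * p q.1 q.2) ^ 2)
      (Eventually.of_forall fun q =>
        (hZ q.1 q.2).integral_sq_subsampleSize_sub_le.1.const_mul _) ?_
    refine tendsto_of_tendsto_of_tendsto_of_le_of_le' tendsto_const_nhds hp.inv_tendsto_atTop
      (Eventually.of_forall fun q => integral_nonneg fun _ => abs_nonneg _) ?_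
    filter_upwards [hp.eventually_gt_atTop 0] with q hq
    have hle := (hZ q.1 q.2).integral_sq_subsampleSize_sub_le.2
    have habs : ∀ ω, |(((q.1 : ℝ) * q.2 * p q.1 q.2)⁻¹) ^ 2 *
        (subsampleSize (Z q.1 q.2) ω - (q.1 : ℝ) * q.2 * p q.1 q.2) ^ 2| =
        (((q.1 : ℝ) * q.2 * p q.1 q.2)⁻¹) ^ 2 *
        (subsampleSize (Z q.1 q.2) ω - (q.1 : ℝ) * q.2 * p q.1 q.2) ^ 2 :=
      fun ω => abs_of_nonneg (by positivity)
    simp only [habs, Pi.inv_apply]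
    rw [integral_const_mul]
    generalize (q.1 : ℝ) * q.2 * p q.1 q.2 = a at hq hle ⊢
    calc _ ≤ a⁻¹ ^ 2 * a := by gcongr
      _ = a⁻¹ := by field_simp
  have habs := hsq.sqrt
  simp only [← mul_pow, Real.sqrt_sq_eq_abs, Real.sqrt_zero] at habs
  have hsub := (tendsto_zero_iff_abs_tendsto_zero _).mpr habs
  have hadd := hsub.add_const 1
  rw [zero_add] at hadd
  refine hadd.congr' (eventually_highProbability_of_ae ?_)
  filter_upwards [hp.eventually_gt_atTop 0] with q hq
  refine Eventually.of_forall fun ω => ?_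
  rw [mul_sub, inv_mul_cancel₀ hq.ne', sub_add_cancel]

/-- Subsample averages converge in probability to the population mean. -/
theorem tendsto_subsampleMean (hW : ∀ i j, Measurable (W i j))
    (hexch : SeparatelyExchangeable P W) (hdiss : Dissociated P W)
    (hp : Tendsto (fun q : ℕ × ℕ => (q.1 : ℝ) * (q.2 : ℝ) * (p q.1 q.2 : ℝ))
      sizesToInfinity atTop)
    (hZ : ∀ N M, IsBernoulliSubsample P W N M (p N M) (Z N M)) {f : Vec d → ℝ}
    (hf : Measurable f) (hint : Integrable (fun ω => f (W 0 0 ω)) P) :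
    Tendsto (fun a : (ℕ × ℕ) × Ω => (subsampleSize (Z a.1.1 a.1.2) a.2)⁻¹ *
      subsampleSum W f (Z a.1.1 a.1.2) a.2) (highProbability P sizesToInfinity)
      (𝓝 (∫ ω, f (W 0 0 ω) ∂P)) := by
  set c := ∫ ω, f (W 0 0 ω) ∂P with hc
  have hfc : Integrable (fun ω => f (W 0 0 ω) - c) P := hint.sub (integrable_const c)
  have hcent := tendsto_highProbability_of_integral_abs (Eventually.of_forall fun q : ℕ × ℕ =>
      ((hZ q.1 q.2).integrable_subsampleSum (f := fun w => f w - c) hexch (hf.sub_const c)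
        hfc).const_mul ((q.1 : ℝ) * q.2 * p q.1 q.2)⁻¹)
    (tendsto_integral_abs_subsampleSum (f := fun w => f w - c) hW hexch hdiss hp hZ
      (hf.sub_const c) hfc (by rw [integral_sub hint (integrable_const c), ← hc]; simp))
  have hsize := tendsto_subsampleSize_div hp hZ
  -- The centred sum over a, divided by L̂ / a, is the subsample mean minus `c` once a > 0 and L̂ ≠
  -- 0, which holds with probability tending to one.
  have hlim := (hcent.div hsize one_ne_zero).add_const c
  rw [zero_div, zero_add] at hlim
  refine hlim.congr' ?_
  have hpos : ∀ᶠ a : (ℕ × ℕ) × Ω in highProbability P sizesToInfinity,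
      0 < (a.1.1 : ℝ) * a.1.2 * p a.1.1 a.1.2 := by
    refine eventually_highProbability_of_ae ?_
    filter_upwards [hp.eventually_gt_atTop 0] with q hq
    exact Eventually.of_forall fun ω => hq
  filter_upwards [hpos, hsize.eventually (lt_mem_nhds one_pos)] with a ha hL
  have hL' : subsampleSize (Z a.1.1 a.1.2) a.2 ≠ 0 := by
    intro h
    rw [h, mul_zero] at hL
    exact lt_irrefl _ hL
  have hsum : subsampleSum W (fun w => f w - c) (Z a.1.1 a.1.2) a.2 =
      subsampleSum W f (Z a.1.1 a.1.2) a.2 - subsampleSize (Z a.1.1 a.1.2) a.2 * c := by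
    simp only [subsampleSum, subsampleSize, mul_sub, Finset.sum_sub_distrib,
      Fintype.sum_prod_type, Finset.sum_mul]
  simp only [Pi.div_apply]
  rw [hsum, mul_div_mul_left _ _ (inv_ne_zero ha.ne')]
  field_simp
  ring

end LawOfLargeNumbers

/-! ### From the law of large numbers to the GMM criterion -/

theorem sampleMoment_apply {Ω : Type*} {d k m N M : ℕ} (W : ℕ → ℕ → Ω → Vec d)
    (g : Vec d → Vec k → Vec m) (Z : Fin N → Fin M → Ω → ℝ) (ω : Ω) (θ : Vec k) (r : Fin m) :
    sampleMoment W g Z ω θ r =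
      (subsampleSize Z ω)⁻¹ * subsampleSum W (fun w => g w θ r) Z ω := by
  simp [sampleMoment, subsampleSum, Fintype.sum_prod_type]

/-- Averages with nonnegative weights inherit a Lipschitz bound. -/
theorem abs_sampleMoment_sub_le {Ω : Type*} {d k m : ℕ}
    {W : ℕ → ℕ → Ω → Vec d} {g : Vec d → Vec k → Vec m} {N M : ℕ}
    {Y : Fin N → Fin M → Ω → ℝ} {ω : Ω} (hL : 0 < subsampleSize Y ω)
    (hY : ∀ i j, 0 ≤ Y i j ω) {θ θ' : Vec k} {r : Fin m} {C : ℝ}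
    (hg : ∀ (i : Fin N) (j : Fin M), |g (W i j ω) θ r - g (W i j ω) θ' r| ≤ C) :
    |sampleMoment W g Y ω θ r - sampleMoment W g Y ω θ' r| ≤ C := by
  rw [sampleMoment_apply, sampleMoment_apply, ← mul_sub, abs_mul, abs_of_pos (inv_pos.mpr hL),
    inv_mul_le_iff₀ hL]
  simp only [subsampleSum, ← Finset.sum_sub_distrib, ← mul_sub]
  calc _ ≤ ∑ q : Fin N × Fin M, Y q.1 q.2 ω * C := by
        refine (Finset.abs_sum_le_sum_abs _ _).trans (Finset.sum_le_sum fun q _ => ?_)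
        rw [abs_mul, abs_of_nonneg (hY _ _)]
        exact mul_le_mul_of_nonneg_left (hg _ _) (hY _ _)
    _ = subsampleSize Y ω * C := by
        simp only [subsampleSize, Fintype.sum_prod_type, Finset.sum_mul]

section Consistency

variable {Ω : Type*} [MeasurableSpace Ω] {P : Measure Ω} {d k m : ℕ}
  {W : ℕ → ℕ → Ω → Vec d} {p : ℕ → ℕ → unitInterval} {Z : (N M : ℕ) → Fin N → Fin M → Ω → ℝ}

theorem eventually_subsampleSize_pos [IsProbabilityMeasure P]
    (hp : Tendsto (fun q : ℕ × ℕ => (q.1 : ℝ) * (q.2 : ℝ) * (p q.1 q.2 : ℝ))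
      sizesToInfinity atTop)
    (hZ : ∀ N M, IsBernoulliSubsample P W N M (p N M) (Z N M)) :
    ∀ᶠ a : (ℕ × ℕ) × Ω in highProbability P sizesToInfinity,
      0 < subsampleSize (Z a.1.1 a.1.2) a.2 := by
  have hpos : ∀ᶠ a : (ℕ × ℕ) × Ω in highProbability P sizesToInfinity,
      0 < (a.1.1 : ℝ) * a.1.2 * p a.1.1 a.1.2 := by
    refine eventually_highProbability_of_ae ?_
    filter_upwards [hp.eventually_gt_atTop 0] with q hq
    exact Eventually.of_forall fun ω => hq
  filter_upwards [hpos,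
    (tendsto_subsampleSize_div hp hZ).eventually (lt_mem_nhds one_pos)] with a ha hL
  exact (mul_pos_iff_of_pos_left (inv_pos.mpr ha)).mp hL

/-- The Lipschitz hypothesis holds only on the support of the common law; this places every
observation there almost surely. -/
theorem SeparatelyExchangeable.ae_mem_support (hexch : SeparatelyExchangeable P W)
    (hW : ∀ i j, Measurable (W i j)) (i j : ℕ) :
    ∀ᵐ ω ∂P, W i j ω ∈ (P.map (W 0 0)).support := by
  rw [(hexch.identDistrib_entry i j).map_eq]
  exact ae_of_ae_map (hW i j).aemeasurable Measure.support_mem_ae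

/-- The supremum over `Θ` need not be measurable, but monotonicity of the lower integral does not
require it. -/
theorem integrable_of_envelope {X : Ω → Vec d} (hX : Measurable X)
    {g : Vec d → Vec k → Vec m} {Θ : Set (Vec k)} (hg : ∀ θ ∈ Θ, Measurable fun w => g w θ)
    (henv : ∫⁻ ω, ⨆ θ ∈ Θ, ‖g (X ω) θ‖ₑ ∂P < ⊤) {θ : Vec k} (hθ : θ ∈ Θ) :
    Integrable (fun ω => g (X ω) θ) P :=
  ⟨((hg θ hθ).comp hX).aestronglyMeasurable,
    (lintegral_mono fun ω => le_iSup₂ (f := fun θ _ => ‖g (X ω) θ‖ₑ) θ hθ).trans_lt henv⟩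

end Consistency

end MultiwayGMM

/-! ### Consistency of the estimator -/

theorem lemma2
    {Ω : Type*} [MeasurableSpace Ω] (P : Measure Ω) [IsProbabilityMeasure P]
    (d k m : ℕ)
    -- the data: a separately exchangeable and dissociated array
    (W : ℕ → ℕ → Ω → MultiwayGMM.Vec d) (hW : ∀ i j, Measurable (W i j))
    (hexch : MultiwayGMM.SeparatelyExchangeable P W)
    (hdiss : MultiwayGMM.Dissociated P W)
    -- Bernoulli subsampling, with expected subsample size tending to infinity
    (p : ℕ → ℕ → unitInterval)
    (hp : Tendsto (fun q : ℕ × ℕ => (q.1 : ℝ) * (q.2 : ℝ) * (p q.1 q.2 : ℝ))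
      MultiwayGMM.sizesToInfinity atTop)
    (Z : (N M : ℕ) → Fin N → Fin M → Ω → ℝ)
    (hZ : ∀ N M, MultiwayGMM.IsBernoulliSubsample P W N M (p N M) (Z N M))
    -- the parameter set and the moment functions
    (Θ : Set (MultiwayGMM.Vec k)) (hΘ : IsCompact Θ)
    (θ₀ : MultiwayGMM.Vec k) (hθ₀ : θ₀ ∈ interior Θ)
    (g : MultiwayGMM.Vec d → MultiwayGMM.Vec k → MultiwayGMM.Vec m)
    (hg : ∀ θ ∈ Θ, Measurable (fun w => g w θ))
    (hLip : ∃ K : ℝ, ∀ w ∈ (P.map (W 0 0)).support, ∀ r : Fin m, ∀ θ ∈ Θ, ∀ θ' ∈ Θ,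
      |g w θ r - g w θ' r| ≤ K * ‖θ - θ'‖)
    (henv : ∫⁻ ω, ⨆ θ ∈ Θ, ‖g (W 0 0 ω) θ‖ₑ ∂P < ⊤)
    -- the moment restriction and identification
    (hmom : MultiwayGMM.populationMoment P W g θ₀ = 0)
    (V : Matrix (Fin m) (Fin m) ℝ) (hV : V.PosSemidef)
    (hid : ∀ θ ∈ Θ, V *ᵥ (MultiwayGMM.populationMoment P W g θ).ofLp = 0 → θ = θ₀)
    -- the weighting matrices
    (Vhat : ℕ → ℕ → Ω → Matrix (Fin m) (Fin m) ℝ)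
    (hVhat : ∀ N M, ∀ᵐ ω ∂P, (Vhat N M ω).PosSemidef)
    (hVlim : ∀ r s : Fin m,
      TendstoInMeasure P (fun (q : ℕ × ℕ) ω => Vhat q.1 q.2 ω r s)
        MultiwayGMM.sizesToInfinity (fun _ => V r s))
    -- the estimator
    (θhat : ℕ → ℕ → Ω → MultiwayGMM.Vec k)
    (hθhat : ∀ N M,
      MultiwayGMM.IsGMMEstimator P W g (Z N M) (Vhat N M) Θ (θhat N M)) :
    TendstoInMeasure P (fun (q : ℕ × ℕ) => θhat q.1 q.2)
      MultiwayGMM.sizesToInfinity (fun _ => θ₀) := by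
  obtain ⟨K, hK⟩ := hLip
  have hθ₀' : θ₀ ∈ Θ := interior_subset hθ₀
  have hint : ∀ θ ∈ Θ, Integrable (fun ω => g (W 0 0 ω) θ) P := fun θ hθ =>
    MultiwayGMM.integrable_of_envelope (hW 0 0) hg henv hθ
  have hsize := MultiwayGMM.eventually_subsampleSize_pos hp hZ
  have hest : ∀ᶠ a : (ℕ × ℕ) × Ω in
      MultiwayGMM.highProbability P MultiwayGMM.sizesToInfinity,
      θhat a.1.1 a.1.2 a.2 ∈ Θ ∧ IsMaxOn (MultiwayGMM.gmmCriterion W g (Z a.1.1 a.1.2)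
        (Vhat a.1.1 a.1.2 a.2) a.2) Θ (θhat a.1.1 a.1.2 a.2) := by
    filter_upwards [hsize, MultiwayGMM.eventually_highProbability_of_ae
      (p := fun a : (ℕ × ℕ) × Ω => 0 < MultiwayGMM.subsampleSize (Z a.1.1 a.1.2) a.2 →
        θhat a.1.1 a.1.2 a.2 ∈ Θ ∧ IsMaxOn (MultiwayGMM.gmmCriterion W g (Z a.1.1 a.1.2)
          (Vhat a.1.1 a.1.2 a.2) a.2) Θ (θhat a.1.1 a.1.2 a.2))
      (Eventually.of_forall fun q => hθhat q.1 q.2)] with a ha h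
    exact h ha
  have hlip : ∀ᶠ a : (ℕ × ℕ) × Ω in
      MultiwayGMM.highProbability P MultiwayGMM.sizesToInfinity,
      ∀ r, ∀ θ ∈ Θ, ∀ θ' ∈ Θ,
        |(MultiwayGMM.sampleMoment W g (Z a.1.1 a.1.2) a.2 θ).ofLp r -
          (MultiwayGMM.sampleMoment W g (Z a.1.1 a.1.2) a.2 θ').ofLp r| ≤ K * ‖θ - θ'‖ := by
    have hsupp : ∀ᶠ a : (ℕ × ℕ) × Ω in
        MultiwayGMM.highProbability P MultiwayGMM.sizesToInfinity,
        ∀ (i : Fin a.1.1) (j : Fin a.1.2), 0 ≤ Z a.1.1 a.1.2 i j a.2 ∧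
          W i j a.2 ∈ (P.map (W 0 0)).support := by
      refine MultiwayGMM.eventually_highProbability_of_ae (Eventually.of_forall fun q => ?_)
      simp only [ae_all_iff]
      intro i j
      filter_upwards [(hZ q.1 q.2).ae_eq_one_or_zero i j, hexch.ae_mem_support hW i j]
        with ω h1 h2
      refine ⟨?_, h2⟩
      rcases h1 with h1 | h1 <;> rw [h1]
      -- Only the value 1 remains: `rw` has already closed 0 ≤ 0 by reflexivity.
      exact zero_le_one
    filter_upwards [hsize, hsupp] with a ha h r θ hθ θ' hθ'
    exact MultiwayGMM.abs_sampleMoment_sub_le ha (fun i j => (h i j).1)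
      fun i j => hK _ (h i j).2 r θ hθ θ' hθ'
  have hmoment : ∀ θ ∈ Θ, Tendsto
      (fun a : (ℕ × ℕ) × Ω => (MultiwayGMM.sampleMoment W g (Z a.1.1 a.1.2) a.2 θ).ofLp)
      (MultiwayGMM.highProbability P MultiwayGMM.sizesToInfinity)
      (nhds (MultiwayGMM.populationMoment P W g θ).ofLp) := by
    intro θ hθ
    rw [tendsto_pi_nhds]
    intro r
    -- Coordinates commute with the vector-valued integral, so the scalar law of large numbers
    -- applies to each one.
    have hr : (MultiwayGMM.populationMoment P W g θ).ofLp r = ∫ ω, g (W 0 0 ω) θ r ∂P :=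
      ((EuclideanSpace.proj (𝕜 := ℝ) r).integral_comp_comm (hint θ hθ)).symm
    simp only [MultiwayGMM.sampleMoment_apply, hr]
    exact MultiwayGMM.tendsto_subsampleMean (f := fun w => g w θ r) hW hexch hdiss hp hZ
      ((EuclideanSpace.proj (𝕜 := ℝ) r).continuous.measurable.comp (hg θ hθ))
      ((EuclideanSpace.proj (𝕜 := ℝ) r).integrable_comp (hint θ hθ))
  have hweight : Tendsto (fun a : (ℕ × ℕ) × Ω => Vhat a.1.1 a.1.2 a.2)
      (MultiwayGMM.highProbability P MultiwayGMM.sizesToInfinity) (nhds V) := by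
    have hentry := fun r s => MultiwayGMM.tendstoInMeasure_const_iff.mp (hVlim r s)
    exact tendsto_pi_nhds.mpr fun r => tendsto_pi_nhds.mpr fun s => hentry r s
  have hmin : ∀ᶠ a : (ℕ × ℕ) × Ω in
      MultiwayGMM.highProbability P MultiwayGMM.sizesToInfinity,
      IsMinOn (fun θ => (MultiwayGMM.sampleMoment W g (Z a.1.1 a.1.2) a.2 θ).ofLp ⬝ᵥ
        (Vhat a.1.1 a.1.2 a.2 *ᵥ (MultiwayGMM.sampleMoment W g (Z a.1.1 a.1.2) a.2 θ).ofLp))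
        Θ (θhat a.1.1 a.1.2 a.2) := by
    filter_upwards [hest] with a ha
    exact isMinOn_iff.mpr fun θ hθ => neg_le_neg_iff.mp (isMaxOn_iff.mp ha.2 θ hθ)
  have hzero : (MultiwayGMM.populationMoment P W g θ₀).ofLp = 0 := by
    rw [hmom]
    rfl
  rw [MultiwayGMM.tendstoInMeasure_const_iff]
  exact MultiwayGMM.tendsto_of_isMinOn_quadratic
    (G := fun θ => (MultiwayGMM.populationMoment P W g θ).ofLp)
    (H := fun (a : (ℕ × ℕ) × Ω) θ =>
      (MultiwayGMM.sampleMoment W g (Z a.1.1 a.1.2) a.2 θ).ofLp)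
    (A := fun a : (ℕ × ℕ) × Ω => Vhat a.1.1 a.1.2 a.2)
    (θhat := fun a : (ℕ × ℕ) × Ω => θhat a.1.1 a.1.2 a.2)
    hΘ hθ₀' hzero hV hid hlip hmoment hweight (hest.mono fun a h => h.1) hmin
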